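/- Let $G$ be a finite group that is not nilpotent, with $|G| = p^a q^b$ for primes $p < q$ and integers $a, b \ge 0$ (non-nilpotency then forces $a, b \ge 1$). Let $|\operatorname{Sub} G|$ be the number of subgroups of $G$. Then $$|\operatorname{Sub} G| \ge \min\{\, bq+ab+a+1,\;\; b(q+1)+2a+(a-1)\min(p,b),\;\; b+q+1+(b-1)\min(a,q)+m_p \,\},$$ where the second term is included in the minimum only if $b>1$, and the third term is included only if $a>1$, in which case $m_p$ is defined as follows: if $p=2$ and $a=2$ then $m_p=5$; if $p=2$ and $a=3$ then $m_p=6$; and if $p\neq 2$ or $a\ge 4$ then $m_p=(a-1)(p+1)+2$. -/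

import Mathlib

/-- The lower bound `m_p` for the number of subgroups of a non-cyclic group of order `p ^ a`
(it is only used for `a > 1`). -/
def noncyclicPGroupBound (p a : ℕ) : ℕ :=
  if p = 2 ∧ a = 2 then 5
  else if p = 2 ∧ a = 3 then 6
  else (a - 1) * (p + 1) + 2

/-- The first term of the minimum; it is always present. -/
def boundFst (q a b : ℕ) : ℕ := b * q + a * b + a + 1

/-- The second term of the minimum; it is present only if `b > 1`. -/
def boundSnd (p q a b : ℕ) : ℕ := b * (q + 1) + 2 * a + (a - 1) * min p b

/-- The third term of the minimum; it is present only if `a > 1`. -/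
def boundThd (p q a b : ℕ) : ℕ :=
  b + q + 1 + (b - 1) * min a q + noncyclicPGroupBound p a

/-- The minimum of those terms that are present. An absent term is `⊤`, so it does not affect
the minimum. -/
noncomputable def nonnilpotentBound (p q a b : ℕ) : ℕ∞ :=
  min (boundFst q a b : ℕ∞)
    (min (if 1 < b then (boundSnd p q a b : ℕ∞) else ⊤)
      (if 1 < a then (boundThd p q a b : ℕ∞) else ⊤))

/-! Sort the subgroups by order. Lagrange leaves a grid of orders `p ^ i * q ^ j`, and each bound is
a sum over this grid of lower bounds for single cells or lines.

Two facts feed the cells. The number of subgroups of a given prime power order dividing the group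
order is 1 or at least one more than the prime (`le_numSubgroups_prime_pow`); when it is 1, the
subgroup N is normal, and multiplying by N injects the subgroups of a complementary Sylow subgroup
into the line of the grid through N (`numSubgroups_subgroup_le`). A non-normal subgroup whose
normalizer has q-power index has at least q conjugates.

Let P and Q be Sylow subgroups for p and q; they are not both normal. If P is cyclic, Burnside
transfer makes Q normal, since p is the smaller prime, so P is not normal. Then Q cyclic gives the
first term (`boundFst_le`), Q noncyclic the second (`boundSnd_le`). If P is noncyclic, the third
term holds (`boundThd_le`). The last two also need a lower bound for the number of subgroups of a
noncyclic p-group (`noncyclicPGroupBound_le`), proved by descending through noncyclic maximal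
subgroups. -/

open Subgroup

/-- The number of subgroups of order `n` of `G`. -/
noncomputable def numSubgroups (G : Type*) [Group G] (n : ℕ) : ℕ :=
  {H : Subgroup G | Nat.card H = n}.ncard

/-! ### Counting subgroups by order -/

section Counting

variable {G : Type*} [Group G]

theorem sum_numSubgroups_le [Finite G] {ι : Type*} (s : Finset ι) (f : ι → ℕ) (hf : Set.InjOn f s) :
    ∑ x ∈ s, numSubgroups G (f x) ≤ Nat.card (Subgroup G) := by
  classical
  have : Fintype (Subgroup G) := Fintype.ofFinite _
  have h1 : ∀ n, numSubgroups G n = (Finset.univ.filter fun H : Subgroup G => Nat.card H = n).card := by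
    intro n
    rw [numSubgroups, Set.ncard_eq_toFinset_card']
    congr 1
    ext
    simp
  simp only [h1]
  rw [← Finset.card_biUnion, Nat.card_eq_fintype_card]
  · exact Finset.card_le_univ _
  · intro x hx y hy hxy
    rw [Function.onFun, Finset.disjoint_left]
    intro H h h'
    simp only [Finset.mem_filter, Finset.mem_univ, true_and] at h h'
    exact hxy (hf hx hy (h.symm.trans h'))

theorem card_subgroup_le_sum_numSubgroups [Finite G] (T : Finset ℕ) (hT : ∀ H : Subgroup G, Nat.card H ∈ T) :
    Nat.card (Subgroup G) ≤ ∑ n ∈ T, numSubgroups G n := by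
  classical
  have : Fintype (Subgroup G) := Fintype.ofFinite _
  have h1 : ∀ n, numSubgroups G n = (Finset.univ.filter fun H : Subgroup G => Nat.card H = n).card := by
    intro n
    rw [numSubgroups, Set.ncard_eq_toFinset_card']
    congr 1
    ext
    simp
  simp only [h1]
  rw [Nat.card_eq_fintype_card, ← Finset.card_univ,
    Finset.card_eq_sum_card_fiberwise (f := fun H : Subgroup G => Nat.card H) (t := T)]
  intro H _
  exact hT H

theorem sum_numSubgroups_prime_pow [Finite G] {p n : ℕ} (hp : p.Prime) (h : Nat.card G = p ^ n) :
    Nat.card (Subgroup G) = ∑ i ∈ Finset.range (n + 1), numSubgroups G (p ^ i) := by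
  apply le_antisymm
  · have h1 := card_subgroup_le_sum_numSubgroups (G := G)
      ((Finset.range (n + 1)).image fun i => p ^ i) ?_
    · rwa [Finset.sum_image fun x _ y _ hxy => Nat.pow_right_injective hp.two_le hxy] at h1
    · intro H
      have := card_subgroup_dvd_card H
      rw [h, Nat.dvd_prime_pow hp] at this
      obtain ⟨k, hk, hk'⟩ := this
      simp only [Finset.mem_image, Finset.mem_range]
      exact ⟨k, by omega, hk'.symm⟩
  · exact sum_numSubgroups_le _ _ fun x _ y _ hxy => Nat.pow_right_injective hp.two_le hxy

theorem sum_sum_numSubgroups_le [Finite G] {p q : ℕ} (hp : p.Prime) (hq : q.Prime) (hpq : p ≠ q) (a b : ℕ) :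
    ∑ i ∈ Finset.range (a + 1), ∑ j ∈ Finset.range (b + 1), numSubgroups G (p ^ i * q ^ j) ≤
      Nat.card (Subgroup G) := by
  rw [← Finset.sum_product']
  apply sum_numSubgroups_le _ (fun x : ℕ × ℕ => p ^ x.1 * q ^ x.2)
  have hcop : ∀ i j, (p ^ i).Coprime (q ^ j) := fun i j =>
    Nat.Coprime.pow _ _ ((Nat.coprime_primes hp hq).2 hpq)
  have key : ∀ i j i' j', p ^ i * q ^ j = p ^ i' * q ^ j' → i ≤ i' ∧ j ≤ j' := by
    intro i j i' j' h
    refine ⟨(Nat.pow_dvd_pow_iff_le_right hp.one_lt).1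
      ((hcop i j').dvd_of_dvd_mul_right (h ▸ Dvd.intro _ rfl)),
      (Nat.pow_dvd_pow_iff_le_right hq.one_lt).1
      ((hcop i' j).symm.dvd_of_dvd_mul_left (h ▸ Dvd.intro_left _ rfl))⟩
  rintro ⟨i, j⟩ _ ⟨i', j'⟩ _ h
  have h1 := key _ _ _ _ h
  have h2 := key _ _ _ _ h.symm
  exact Prod.ext (le_antisymm h1.1 h2.1) (le_antisymm h1.2 h2.2)

theorem numSubgroups_pos [Finite G] {n : ℕ} (H : Subgroup G) (hH : Nat.card H = n) : 1 ≤ numSubgroups G n :=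
  (Set.ncard_pos (Set.toFinite _)).2 ⟨H, hH⟩

theorem numSubgroups_prime_pow_pos [Finite G] {p i : ℕ} (hp : p.Prime) (h : p ^ i ∣ Nat.card G) :
    1 ≤ numSubgroups G (p ^ i) := by
  have := Fact.mk hp
  obtain ⟨K, hK⟩ := Sylow.exists_subgroup_card_pow_prime p h
  exact numSubgroups_pos K hK

theorem numSubgroups_card [Finite G] : numSubgroups G (Nat.card G) = 1 := by
  rw [numSubgroups, Set.ncard_eq_one]
  refine ⟨⊤, ?_⟩
  ext H
  simp only [Set.mem_ofPred_eq, Set.mem_singleton_iff]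
  exact ⟨fun h => Subgroup.eq_top_of_card_eq _ h, fun h => by rw [h]; simp⟩

theorem eq_of_numSubgroups_eq_one {n : ℕ} (h : numSubgroups G n = 1) {H K : Subgroup G}
    (hH : Nat.card H = n) (hK : Nat.card K = n) : H = K := by
  rw [numSubgroups, Set.ncard_eq_one] at h
  obtain ⟨L, hL⟩ := h
  have h1 : H ∈ ({L} : Set (Subgroup G)) := hL ▸ hH
  have h2 : K ∈ ({L} : Set (Subgroup G)) := hL ▸ hK
  rw [Set.mem_singleton_iff] at h1 h2
  rw [h1, h2]

theorem numSubgroups_eq_one {n : ℕ} (H : Subgroup G) (hH : Nat.card H = n)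
    (h : ∀ K : Subgroup G, Nat.card K = n → K = H) : numSubgroups G n = 1 := by
  rw [numSubgroups, Set.ncard_eq_one]
  refine ⟨H, ?_⟩
  ext K
  exact ⟨h K, fun hK => by rw [Set.mem_singleton_iff] at hK; rw [hK]; exact hH⟩

theorem normal_of_forall_card_eq (H : Subgroup G)
    (h : ∀ K : Subgroup G, Nat.card K = Nat.card H → K = H) : H.Normal := by
  refine Normal.of_conjugate_fixed fun g => h _ ?_
  exact Nat.card_congr (equivSMul (MulAut.conj g) H).symm.toEquiv

theorem card_sup_of_disjoint [Finite G] (N K : Subgroup G) [N.Normal] (h : Disjoint N K) :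
    Nat.card (N ⊔ K : Subgroup G) = Nat.card N * Nat.card K := by
  have h1 : N.relIndex K = Nat.card K := by
    rw [← inf_relIndex_right, h.eq_bot, relIndex_bot_left]
  rw [← relIndex_bot_left, ← relIndex_mul_relIndex ⊥ N (N ⊔ K) bot_le le_sup_left,
    sup_comm, relIndex_sup_right, h1, relIndex_bot_left]

/-- The map K ↦ NK is injective on subgroups of Q, because K is recovered as NK ∩ Q. -/
theorem numSubgroups_subgroup_le [Finite G] (N Q : Subgroup G) [N.Normal] (h : Disjoint N Q) (m : ℕ) :
    numSubgroups Q m ≤ numSubgroups G (Nat.card N * m) := by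
  refine Set.ncard_le_ncard_of_injOn (fun K => N ⊔ K.map Q.subtype) ?_ ?_ (Set.toFinite _)
  · intro K hK
    simp only [Set.mem_ofPred_eq] at hK ⊢
    rw [card_sup_of_disjoint _ _ (h.mono_right (map_subtype_le K)),
      Nat.card_congr (K.equivMapOfInjective _ Q.subtype_injective).symm.toEquiv, hK]
  · have key : ∀ K K' : Subgroup Q, N ⊔ K.map Q.subtype = N ⊔ K'.map Q.subtype → K ≤ K' := by
      intro K K' hKK x hx
      have hx1 : (x : G) ∈ N ⊔ K'.map Q.subtype := by
        rw [← hKK]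
        exact mem_sup_right ⟨x, hx, rfl⟩
      obtain ⟨y, hy, _, ⟨z, hz, rfl⟩, hyz⟩ := mem_sup_of_normal_left.1 hx1
      have hyQ : y ∈ Q := by
        rw [eq_mul_inv_of_mul_eq hyz]
        exact Q.mul_mem x.2 (Q.inv_mem z.2)
      have : y = 1 := by
        have := h.le_bot ⟨hy, hyQ⟩
        simpa using this
      rw [this, one_mul] at hyz
      have : x = z := Subtype.ext hyz.symm
      exact this ▸ hz
    intro K _ K' _ hKK
    exact le_antisymm (key _ _ hKK) (key _ _ hKK.symm)

theorem numSubgroups_subgroup_le_self [Finite G] (Q : Subgroup G) (m : ℕ) :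
    numSubgroups Q m ≤ numSubgroups G m := by
  simpa using numSubgroups_subgroup_le ⊥ Q disjoint_bot_left m

theorem numSubgroups_subgroup_eq (Q : Subgroup G) (m : ℕ) :
    numSubgroups Q m = {H : Subgroup G | Nat.card H = m ∧ H ≤ Q}.ncard := by
  rw [numSubgroups, ← Set.ncard_image_of_injective _ (map_injective Q.subtype_injective)]
  congr 1
  ext H
  constructor
  · rintro ⟨K, hK, rfl⟩
    refine ⟨?_, map_subtype_le K⟩
    rw [Nat.card_congr (K.equivMapOfInjective _ Q.subtype_injective).symm.toEquiv]
    exact hK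
  · rintro ⟨h1, h2⟩
    refine ⟨H.subgroupOf Q, ?_, map_subgroupOf_eq_of_le h2⟩
    rw [Set.mem_ofPred_eq, Nat.card_congr (subgroupOfEquivOfLe h2).toEquiv, h1]

/-- A subgroup of order n consists of solutions of x ^ n = 1, and a cyclic group has at most n of
them. -/
theorem eq_of_card_eq_of_isCyclic [Finite G] [IsCyclic G] {H K : Subgroup G} (h : Nat.card H = Nat.card K) :
    H = K := by
  classical
  have : Fintype G := Fintype.ofFinite G
  have key : ∀ L : Subgroup G, (L : Set G) =
      ((Finset.univ.filter fun x : G => x ^ Nat.card L = 1 : Finset G) : Set G) := by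
    intro L
    apply Set.eq_of_subset_of_ncard_le
    · intro x hx
      have : (⟨x, hx⟩ : L) ^ Nat.card L = 1 := pow_card_eq_one'
      have := congrArg Subtype.val this
      rw [Finset.mem_coe, Finset.mem_filter]
      exact ⟨Finset.mem_univ _, this⟩
    · rw [Set.ncard_coe_finset]
      refine (IsCyclic.card_pow_eq_one_le Nat.card_pos).trans ?_
      rw [← Nat.card_coe_set_eq]
      rfl
    · exact Set.toFinite _
  apply SetLike.coe_injective
  rw [key H, key K, h]

theorem eq_of_le_isCyclic [Finite G] {Q : Subgroup G} (hQ : IsCyclic Q) {H K : Subgroup G} (hH : H ≤ Q)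
    (hK : K ≤ Q) (h : Nat.card H = Nat.card K) : H = K := by
  have : H.subgroupOf Q = K.subgroupOf Q := by
    apply eq_of_card_eq_of_isCyclic
    rw [Nat.card_congr (subgroupOfEquivOfLe hH).toEquiv,
      Nat.card_congr (subgroupOfEquivOfLe hK).toEquiv, h]
  rw [← map_subgroupOf_eq_of_le hH, ← map_subgroupOf_eq_of_le hK, this]

end Counting

/-! ### Subgroups of fixed order in a p-group -/

section PGroup

variable {G : Type*} [Group G]

theorem eq_of_le_of_numSubgroups_eq_one {Q : Subgroup G} {n : ℕ} (hQ : numSubgroups Q n = 1)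
    {H K : Subgroup G} (hH : H ≤ Q) (hK : K ≤ Q) (hHn : Nat.card H = n) (hKn : Nat.card K = n) :
    H = K := by
  have : H.subgroupOf Q = K.subgroupOf Q := by
    apply eq_of_numSubgroups_eq_one hQ
    · rw [Nat.card_congr (subgroupOfEquivOfLe hH).toEquiv, hHn]
    · rw [Nat.card_congr (subgroupOfEquivOfLe hK).toEquiv, hKn]
  rw [← map_subgroupOf_eq_of_le hH, ← map_subgroupOf_eq_of_le hK, this]

theorem exists_maximal_of_lt [Finite G] {p n k : ℕ} (hp : p.Prime) (hG : Nat.card G = p ^ (n + 1))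
    {H : Subgroup G} (hH : Nat.card H = p ^ k) (hk : k ≤ n) :
    ∃ M : Subgroup G, Nat.card M = p ^ n ∧ H ≤ M := by
  have := Fact.mk hp
  exact Sylow.exists_subgroup_card_pow_prime_le p (hG ▸ pow_dvd_pow _ (Nat.le_succ n)) H hH hk

theorem exists_maximal_mem [Finite G] {p n : ℕ} (hp : p.Prime) (hG : Nat.card G = p ^ (n + 1))
    (hc : ¬ IsCyclic G) (x : G) : ∃ M : Subgroup G, Nat.card M = p ^ n ∧ x ∈ M := by
  have h := card_subgroup_dvd_card (zpowers x)
  rw [hG, Nat.dvd_prime_pow hp] at h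
  obtain ⟨k, hk, hk'⟩ := h
  have hkn : k ≠ n + 1 := by
    rintro rfl
    exact hc (isCyclic_of_orderOf_eq_card x (by rw [← Nat.card_zpowers, hk', hG]))
  obtain ⟨M, hM, hxM⟩ := exists_maximal_of_lt hp hG hk' (by omega)
  exact ⟨M, hM, hxM (mem_zpowers x)⟩

/-- Every element of a noncyclic p-group lies in a maximal subgroup. With only p of these, at most
p(p ^ n - 1) nonidentity elements would be covered, fewer than p ^ (n + 1) - 1. -/
theorem le_numSubgroups_maximal [Finite G] {p n : ℕ} (hp : p.Prime)
    (hG : Nat.card G = p ^ (n + 1)) (hc : ¬ IsCyclic G) : p + 1 ≤ numSubgroups G (p ^ n) := by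
  classical
  have : Fintype G := Fintype.ofFinite G
  have : Fintype (Subgroup G) := Fintype.ofFinite _
  set F : Finset (Subgroup G) := Finset.univ.filter fun H => Nat.card H = p ^ n with hF
  have h1 : numSubgroups G (p ^ n) = F.card := by
    rw [numSubgroups, Set.ncard_eq_toFinset_card']
    congr 1
    ext
    simp [hF]
  have h2 : (Finset.univ.erase (1 : G)) ⊆
      F.biUnion fun H => (Finset.univ.filter fun x => x ∈ H).erase 1 := by
    intro x hx
    obtain ⟨M, hM, hxM⟩ := exists_maximal_mem hp hG hc x
    simp only [Finset.mem_biUnion]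
    refine ⟨M, Finset.mem_filter.2 ⟨Finset.mem_univ _, hM⟩, ?_⟩
    rw [Finset.mem_erase] at hx ⊢
    exact ⟨hx.1, by simp [hxM]⟩
  have h3 := (Finset.card_le_card h2).trans
    (Finset.card_biUnion_le_card_mul F _ (p ^ n - 1) ?_)
  · rw [Finset.card_erase_of_mem (Finset.mem_univ _), Finset.card_univ, ← Nat.card_eq_fintype_card,
      hG] at h3
    rw [h1]
    by_contra! h
    have h4 : F.card * (p ^ n - 1) ≤ p * (p ^ n - 1) := Nat.mul_le_mul_right _ (by omega)
    rw [Nat.mul_sub p, mul_one, ← pow_succ'] at h4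
    have h5 : p ≤ p ^ (n + 1) := Nat.le_self_pow (by omega) p
    have := hp.two_le
    omega
  · intro H hH
    rw [Finset.card_erase_of_mem (by simp [H.one_mem])]
    apply Nat.sub_le_sub_right
    rw [← (Finset.mem_filter.1 hH).2, Nat.card_eq_fintype_card, Fintype.card_subtype]

theorem card_inf_maximal [Finite G] {p n : ℕ} (hp : p.Prime) (hG : Nat.card G = p ^ (n + 2))
    {M N : Subgroup G} (hM : Nat.card M = p ^ (n + 1)) (hN : Nat.card N = p ^ (n + 1)) :
    p ^ n ≤ Nat.card (M ⊓ N : Subgroup G) := by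
  have hpos : ∀ k, 0 < p ^ k := fun k => pow_pos hp.pos k
  have hi : ∀ L : Subgroup G, Nat.card L = p ^ (n + 1) → L.index = p := by
    intro L hL
    have := card_mul_index L
    rw [hL, hG, pow_succ p (n + 1)] at this
    exact Nat.eq_of_mul_eq_mul_left (hpos _) this
  have h1 := index_inf_le (H := M) (K := N)
  rw [hi M hM, hi N hN] at h1
  have h2 := card_mul_index (M ⊓ N)
  rw [hG] at h2
  have h3 := Nat.mul_le_mul_left (Nat.card (M ⊓ N : Subgroup G)) h1
  rw [h2, show p ^ (n + 2) = p ^ n * (p * p) by ring] at h3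
  exact Nat.le_of_mul_le_mul_right h3 (Nat.mul_pos hp.pos hp.pos)

/-- Induction on the order: a maximal subgroup with several subgroups of order `p ^ j` settles the
claim. Otherwise each maximal subgroup has a unique one. If these are not themselves maximal, any
two maximal subgroups share theirs, as their intersection is large enough to contain it, so G has
only one. If they are maximal, G is noncyclic and the covering count applies. -/
theorem IsPGroup.le_numSubgroups {p : ℕ} (hp : p.Prime) (n j : ℕ) (hj : j ≤ n)
    {G : Type*} [Group G] [Finite G] (hG : Nat.card G = p ^ n)
    (h : numSubgroups G (p ^ j) ≠ 1) : p + 1 ≤ numSubgroups G (p ^ j) := by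
  induction n generalizing G with
  | zero =>
    obtain rfl : j = 0 := by omega
    exact absurd (hG ▸ numSubgroups_card) h
  | succ n ih =>
    have := Fact.mk hp
    rcases Nat.lt_or_ge n j with hnj | hnj
    · obtain rfl : j = n + 1 := by omega
      exact absurd (hG ▸ numSubgroups_card) h
    by_cases hM : ∃ M : Subgroup G, Nat.card M = p ^ n ∧ numSubgroups M (p ^ j) ≠ 1
    · obtain ⟨M, hM, hM'⟩ := hM
      exact (ih hnj hM hM').trans (numSubgroups_subgroup_le_self M _)
    push Not at hM
    rcases hnj.lt_or_eq with hnj | rfl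
    · exfalso
      obtain ⟨n, rfl⟩ : ∃ m, n = m + 1 := ⟨n - 1, by omega⟩
      obtain ⟨H, hH⟩ := Sylow.exists_subgroup_card_pow_prime p
        (hG ▸ pow_dvd_pow p (by omega : j ≤ n + 1 + 1))
      refine h (numSubgroups_eq_one H hH fun K hK => ?_)
      obtain ⟨M, hMc, hM1⟩ := exists_maximal_of_lt hp hG hH hnj.le
      obtain ⟨N, hNc, hN1⟩ := exists_maximal_of_lt hp hG hK hnj.le
      obtain ⟨L, hL, hLM⟩ := Sylow.exists_subgroup_le_card_pow_prime_of_le_card hp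
        (IsPGroup.of_card hG) ((Nat.pow_le_pow_right hp.pos (by omega : j ≤ n)).trans
          (card_inf_maximal hp hG hMc hNc))
      rw [eq_of_le_of_numSubgroups_eq_one (hM M hMc) hM1 (hL.trans inf_le_left) hH hLM,
        eq_of_le_of_numSubgroups_eq_one (hM N hNc) hN1 (hL.trans inf_le_right) hK hLM]
    · apply le_numSubgroups_maximal hp hG
      intro hc
      obtain ⟨H, hH⟩ := Sylow.exists_subgroup_card_pow_prime p
        (hG ▸ pow_dvd_pow p (by omega : j ≤ j + 1))
      exact h (numSubgroups_eq_one H hH fun K hK => eq_of_card_eq_of_isCyclic (hK.trans hH.symm))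

end PGroup

/-! ### Counting by conjugation -/

section Conjugation

open scoped Pointwise

variable {G : Type*} [Group G]

theorem card_conj_smul (g : G) (H : Subgroup G) :
    Nat.card (MulAut.conj g • H : Subgroup G) = Nat.card H :=
  Nat.card_congr (equivSMul (MulAut.conj g) H).symm.toEquiv

theorem conj_smul_eq_iff_mem_normalizer (g : G) (H : Subgroup G) :
    MulAut.conj g • H = H ↔ g ∈ normalizer (H : Set G) :=
  conjAct_pointwise_smul_iff

/-- The action by conjugation on the subgroups of a given order. -/
@[reducible] def conjActionOnCard (S : Subgroup G) (n : ℕ) :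
    MulAction S {H : Subgroup G // Nat.card H = n} where
  smul g H := ⟨MulAut.conj (g : G) • H.1, (card_conj_smul _ _).trans H.2⟩
  one_smul H := Subtype.ext (by
    change MulAut.conj ((1 : S) : G) • H.1 = H.1
    simp)
  mul_smul g h H := Subtype.ext (by
    change MulAut.conj ((g * h : S) : G) • H.1 = MulAut.conj (g : G) • MulAut.conj (h : G) • H.1
    rw [← mul_smul, ← map_mul, Subgroup.coe_mul])

/-- If a Sylow subgroup S has a unique subgroup H of order `p ^ j`, then H is the only fixed point
of S acting by conjugation: a K normalized by S makes KS a p-group, so K ≤ S. Hence the count is 1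
modulo p. Otherwise the p-group case applies inside S. -/
theorem le_numSubgroups_prime_pow [Finite G] {p j : ℕ} (hp : p.Prime) (hj : p ^ j ∣ Nat.card G)
    (h : numSubgroups G (p ^ j) ≠ 1) : p + 1 ≤ numSubgroups G (p ^ j) := by
  have := Fact.mk hp
  obtain ⟨S⟩ : Nonempty (Sylow p G) := inferInstance
  have hScard := S.card_eq_multiplicity
  have hj' : j ≤ (Nat.card G).factorization p :=
    (hp.pow_dvd_iff_le_factorization Nat.card_pos.ne').1 hj
  by_cases hS : numSubgroups S (p ^ j) = 1
  · obtain ⟨H₀, hH₀⟩ := Sylow.exists_subgroup_card_pow_prime_of_le_card hp S.isPGroup' (n := j)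
      (by rw [hScard]; exact Nat.pow_le_pow_right hp.pos hj')
    set H := H₀.map (S : Subgroup G).subtype
    have hH : Nat.card H = p ^ j := by
      rw [← hH₀, Nat.card_congr (H₀.equivMapOfInjective _ (subtype_injective _)).symm.toEquiv]
    have hHS : H ≤ S := map_subtype_le _
    let _ := conjActionOnCard (S : Subgroup G) (p ^ j)
    have h1 := S.isPGroup'.card_modEq_card_fixedPoints {H : Subgroup G // Nat.card H = p ^ j}
    have h2 : Nat.card (MulAction.fixedPoints S {H : Subgroup G // Nat.card H = p ^ j}) = 1 := by
      refine Nat.card_eq_one_iff_exists.2 ⟨⟨⟨H, hH⟩, fun s => Subtype.ext ?_⟩, ?_⟩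
      · exact eq_of_le_of_numSubgroups_eq_one hS (conj_smul_le_of_le hHS s) hHS
          ((card_conj_smul _ _).trans hH) hH
      · rintro ⟨⟨K, hK⟩, hfix⟩
        refine Subtype.ext (Subtype.ext ?_)
        have hSK : (S : Subgroup G) ≤ normalizer (K : Set G) := fun s hs =>
          (conj_smul_eq_iff_mem_normalizer s K).1 (congrArg Subtype.val (hfix ⟨s, hs⟩))
        have hKS : K ≤ S := by
          rw [← S.is_maximal' ((IsPGroup.of_card hK).to_sup_of_normal_left' S.isPGroup' hSK)
            le_sup_right]
          exact le_sup_left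
        exact eq_of_le_of_numSubgroups_eq_one hS hKS hHS hK hH
    have h3 : Nat.card {H : Subgroup G // Nat.card H = p ^ j} = numSubgroups G (p ^ j) :=
      Nat.card_coe_set_eq _
    rw [h2, h3] at h1
    have h4 := numSubgroups_prime_pow_pos hp hj
    have h5 := Nat.le_of_dvd (by omega) ((Nat.modEq_iff_dvd' h4).1 h1.symm)
    omega
  · exact (IsPGroup.le_numSubgroups hp _ j hj' hScard hS).trans
      (numSubgroups_subgroup_le_self _ _)

/-- The number of conjugates of H is the index of its normalizer, a power of q other than 1. -/
theorem le_numSubgroups_of_not_normal [Finite G] {q b : ℕ} (hq : q.Prime) {H : Subgroup G}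
    (hH : (normalizer (H : Set G)).index ∣ q ^ b) (hn : ¬ H.Normal) :
    q ≤ numSubgroups G (Nat.card H) := by
  let _ : MulAction G (Subgroup G) := MulAction.compHom _ (MulAut.conj (G := G))
  have h1 : MulAction.stabilizer G H = normalizer (H : Set G) := by
    ext g
    exact conj_smul_eq_iff_mem_normalizer g H
  have h2 := MulAction.index_stabilizer G H
  rw [h1] at h2
  have h3 : (MulAction.orbit G H).ncard ≤ numSubgroups G (Nat.card H) := by
    apply Set.ncard_le_ncard _ (Set.toFinite _)
    rintro _ ⟨g, rfl⟩
    exact card_conj_smul g H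
  obtain ⟨k, hk, hk'⟩ := (Nat.dvd_prime_pow hq).1 hH
  rw [← h2, hk'] at h3
  refine le_trans (Nat.le_self_pow ?_ q) h3
  rintro rfl
  rw [pow_zero, index_eq_one, normalizer_eq_top_iff] at hk'
  exact hn hk'

end Conjugation

/-! ### Noncyclic maximal subgroups of p-groups -/

section NoncyclicPGroup

variable {G : Type*} [Group G]

/-- The power formula of nilpotency class two; it turns powering into a homomorphism once the
binomial exponent kills c. -/
theorem mul_pow_of_mul_eq_mul_mul {x y c : G} (hc : ∀ g : G, c * g = g * c)
    (h : y * x = x * y * c) (k : ℕ) :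
    y ^ k * x = x * y ^ k * c ^ k ∧ (x * y) ^ k = x ^ k * y ^ k * c ^ k.choose 2 := by
  have hck : ∀ (m : ℕ) (g : G), c ^ m * g = g * c ^ m := fun m g =>
    (show Commute c g from hc g).pow_left m
  induction k with
  | zero => simp
  | succ k ih =>
    obtain ⟨h1, h2⟩ := ih
    constructor
    · calc y ^ (k + 1) * x = y * (y ^ k * x) := by rw [pow_succ', mul_assoc]
        _ = (y * x) * (y ^ k * c ^ k) := by rw [h1]; group
        _ = x * y * (c * y ^ k) * c ^ k := by rw [h]; group
        _ = x * y ^ (k + 1) * c ^ (k + 1) := by rw [hc, pow_succ', pow_succ']; group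
    · have hch : (k + 1).choose 2 = k + k.choose 2 := by
        rw [Nat.choose_succ_succ' k 1, Nat.choose_one_right]
      calc (x * y) ^ (k + 1) = x ^ k * y ^ k * (c ^ k.choose 2 * (x * y)) := by
            rw [pow_succ, h2, mul_assoc]
        _ = x ^ k * (y ^ k * x) * y * c ^ k.choose 2 := by rw [hck]; group
        _ = x ^ k * x * y ^ k * (c ^ k * y) * c ^ k.choose 2 := by rw [h1]; group
        _ = x ^ (k + 1) * y ^ (k + 1) * c ^ (k + 1).choose 2 := by
            rw [hck, hch, pow_add, pow_succ, pow_succ]; group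

theorem index_of_card_eq_prime_pow {p n : ℕ} (hp : p.Prime) (hG : Nat.card G = p ^ (n + 1))
    {M : Subgroup G} (hM : Nat.card M = p ^ n) : M.index = p := by
  have := card_mul_index M
  rw [hM, hG, pow_succ p n] at this
  exact Nat.eq_of_mul_eq_mul_left (pow_pos hp.pos _) this

theorem normal_of_card_eq_prime_pow [Finite G] {p n : ℕ} (hp : p.Prime) (hG : Nat.card G = p ^ (n + 1))
    {M : Subgroup G} (hM : Nat.card M = p ^ n) : M.Normal := by
  apply normal_of_index_eq_minFac_card
  rw [index_of_card_eq_prime_pow hp hG hM, hG, hp.pow_minFac (by omega)]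

theorem commutator_mem_of_index_prime {p : ℕ} (hp : p.Prime) {M : Subgroup G} [M.Normal]
    (hM : M.index = p) (x y : G) : (x * y)⁻¹ * (y * x) ∈ M := by
  have := Fact.mk hp
  have hc : IsCyclic (G ⧸ M) := isCyclic_of_prime_card (p := p) hM
  rw [← QuotientGroup.eq, QuotientGroup.mk_mul, QuotientGroup.mk_mul]
  exact IsMulCommutative.is_comm.comm _ _

theorem eq_top_of_maximal_le [Finite G] {p n : ℕ} (hp : p.Prime) (hG : Nat.card G = p ^ (n + 1))
    {M N L : Subgroup G} (hM : Nat.card M = p ^ n) (hN : Nat.card N = p ^ n) (hMN : M ≠ N)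
    (hML : M ≤ L) (hNL : N ≤ L) : L = ⊤ := by
  have h := card_subgroup_dvd_card L
  rw [hG, Nat.dvd_prime_pow hp] at h
  obtain ⟨k, hk, hk'⟩ := h
  rcases hk.lt_or_eq with hk | rfl
  · have h1 : p ^ k ≤ p ^ n := Nat.pow_le_pow_right hp.pos (by omega)
    refine absurd ?_ hMN
    rw [eq_of_le_of_card_ge hML (by omega), eq_of_le_of_card_ge hNL (by omega)]
  · exact eq_top_of_card_eq _ (by rw [hk', hG])

/-- The centralizer of d contains both abelian subgroups M and N, which together generate G. -/
theorem inf_cyclic_maximal_central [Finite G] {p n : ℕ} (hp : p.Prime) (hG : Nat.card G = p ^ (n + 1))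
    {M N : Subgroup G} (hM : Nat.card M = p ^ n) (hN : Nat.card N = p ^ n) (hMN : M ≠ N)
    (hMc : IsCyclic M) (hNc : IsCyclic N) {d : G} (hd : d ∈ M ⊓ N) (g : G) : d * g = g * d := by
  have key : ∀ L : Subgroup G, IsCyclic L → d ∈ L → L ≤ centralizer {d} := by
    intro L hL hdL x hx
    rw [mem_centralizer_singleton_iff]
    have : (⟨x, hx⟩ : L) * ⟨d, hdL⟩ = ⟨d, hdL⟩ * ⟨x, hx⟩ := IsMulCommutative.is_comm.comm _ _
    exact congrArg Subtype.val this
  have h := eq_top_of_maximal_le hp hG hM hN hMN (key M hMc hd.1) (key N hNc hd.2)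
  have : g ∈ centralizer {d} := h ▸ mem_top g
  exact (mem_centralizer_singleton_iff.1 this).symm

/-- If all maximal subgroups were cyclic, D = M ∩ N would be central and contain all commutators and
p-th powers. Then x ↦ x ^ (p ^ e) is a homomorphism with image so small that its kernel contains a
subgroup of order p ^ (e + 1). That subgroup lies in a maximal one, so it is cyclic, yet its
exponent divides p ^ e. The choice e = 1 serves odd p and e = 2 serves p = 2; the quaternion group
shows that e = 1 fails for p = 2. -/
theorem exists_not_isCyclic_maximal [Finite G] {p n e : ℕ} (hp : p.Prime) (hG : Nat.card G = p ^ (n + 1))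
    (hc : ¬ IsCyclic G) (he : 1 ≤ e) (hen : e + 1 ≤ n) (hpe : p ∣ (p ^ e).choose 2) :
    ∃ M : Subgroup G, Nat.card M = p ^ n ∧ ¬ IsCyclic M := by
  have := Fact.mk hp
  by_contra! hall
  obtain ⟨M, hM, N, hN, hMN⟩ : ∃ M : Subgroup G, Nat.card M = p ^ n ∧ ∃ N : Subgroup G,
      Nat.card N = p ^ n ∧ M ≠ N := by
    have h := le_numSubgroups_maximal hp hG hc
    have := hp.two_le
    obtain ⟨M, hM, N, hN, hMN⟩ := (Set.one_lt_ncard (Set.toFinite _)).1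
      (show 1 < {H : Subgroup G | Nat.card H = p ^ n}.ncard from by
        change 1 < numSubgroups G (p ^ n); omega)
    exact ⟨M, hM, N, hN, hMN⟩
  have hMn := normal_of_card_eq_prime_pow hp hG hM
  have hNn := normal_of_card_eq_prime_pow hp hG hN
  have hMi := index_of_card_eq_prime_pow hp hG hM
  have hNi := index_of_card_eq_prime_pow hp hG hN
  set D := M ⊓ N with hD
  have hcent : ∀ d ∈ D, ∀ g : G, d * g = g * d := fun d hd g =>
    inf_cyclic_maximal_central hp hG hM hN hMN (hall M hM) (hall N hN) hd g
  have hpow : ∀ x : G, x ^ p ∈ D := fun x =>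
    ⟨hMi ▸ M.pow_index_mem x, hNi ▸ N.pow_index_mem x⟩
  have hmul : ∀ x y : G, (x * y) ^ p ^ e = x ^ p ^ e * y ^ p ^ e := by
    intro x y
    set c := (x * y)⁻¹ * (y * x) with hcdef
    have hcD : c ∈ D := ⟨commutator_mem_of_index_prime hp hMi x y,
      commutator_mem_of_index_prime hp hNi x y⟩
    have hyx : y * x = x * y * c := by rw [hcdef]; group
    -- The p-th power of y lies in D, hence is central, so moving it past x costs nothing.
    have hcp : c ^ p = 1 := by
      have h1 := (mul_pow_of_mul_eq_mul_mul (hcent c hcD) hyx p).1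
      rw [hcent _ (hpow y), eq_comm, mul_eq_left] at h1
      exact h1
    rw [(mul_pow_of_mul_eq_mul_mul (hcent c hcD) hyx (p ^ e)).2]
    obtain ⟨k, hk⟩ := hpe
    rw [hk, pow_mul, hcp, one_pow, mul_one]
  let φ : G →* G := ⟨⟨fun x => x ^ p ^ e, one_pow _⟩, hmul⟩
  have hDlt : Nat.card D ∣ p ^ (n - 1) := by
    have h := card_dvd_of_le (inf_le_left : D ≤ M)
    rw [hM, Nat.dvd_prime_pow hp] at h
    obtain ⟨k, hk, hk'⟩ := h
    rw [hk']
    apply pow_dvd_pow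
    rcases hk.lt_or_eq with hk | rfl
    · omega
    · exfalso
      apply hMN
      rw [← eq_of_le_of_card_ge (inf_le_left : D ≤ M) (by omega)]
      exact eq_of_le_of_card_ge inf_le_right (by omega)
  have hDc : IsCyclic D := by
    have := hall M hM
    exact isCyclic_of_injective (inclusion (inf_le_left : D ≤ M)) (inclusion_injective _)
  obtain ⟨d, hd⟩ := hDc.exists_generator
  -- Since x ^ p is already a power of the generator d of D, only p ^ (e - 1) further powering
  -- remains.
  have hrange : φ.range ≤ zpowers ((d : G) ^ p ^ (e - 1)) := by
    rintro _ ⟨x, rfl⟩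
    obtain ⟨k, hk⟩ := mem_zpowers_iff.1 (hd ⟨x ^ p, hpow x⟩)
    have hk := congrArg Subtype.val hk
    rw [mem_zpowers_iff]
    refine ⟨k, ?_⟩
    change _ = x ^ p ^ e
    have : x ^ p ^ e = (x ^ p) ^ p ^ (e - 1) := by
      rw [← pow_mul, ← pow_succ']
      congr 2
      omega
    rw [this, ← show ((d ^ k : D) : G) = x ^ p from hk, Subgroup.coe_zpow]
    rw [← zpow_natCast, ← zpow_natCast, ← zpow_mul, ← zpow_mul, mul_comm]
  have hcr : Nat.card φ.range ∣ p ^ (n - e) := by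
    refine (card_dvd_of_le hrange).trans ?_
    rw [Nat.card_zpowers, orderOf_dvd_iff_pow_eq_one, ← pow_mul, ← pow_add,
      show e - 1 + (n - e) = n - 1 by omega]
    have : d ^ p ^ (n - 1) = 1 := by
      obtain ⟨m, hm⟩ := hDlt
      rw [hm, pow_mul, pow_card_eq_one', one_pow]
    exact congrArg Subtype.val this
  have hker : p ^ (e + 1) ≤ Nat.card φ.ker := by
    have h1 := card_mul_index φ.ker
    rw [index_ker, hG] at h1
    have h2 := Nat.mul_le_mul_left (Nat.card φ.ker) (Nat.le_of_dvd (pow_pos hp.pos _) hcr)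
    rw [h1, show n + 1 = (e + 1) + (n - e) by omega, pow_add] at h2
    exact Nat.le_of_mul_le_mul_right h2 (pow_pos hp.pos _)
  obtain ⟨L, hL, hLc⟩ := Sylow.exists_subgroup_le_card_pow_prime_of_le_card hp
    (IsPGroup.of_card hG) hker
  obtain ⟨K, hK, hLK⟩ := exists_maximal_of_lt hp hG hLc hen
  have hLcyc : IsCyclic L := by
    have := hall K hK
    exact isCyclic_of_injective (inclusion hLK) (inclusion_injective _)
  obtain ⟨l, hl⟩ := hLcyc.exists_generator
  have h1 : orderOf l ∣ p ^ e := by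
    rw [orderOf_dvd_iff_pow_eq_one]
    exact Subtype.ext (hL l.2)
  rw [orderOf_eq_card_of_forall_mem_zpowers hl, hLc, Nat.pow_dvd_pow_iff_le_right hp.one_lt] at h1
  omega

end NoncyclicPGroup

/-! ### Number of subgroups of a noncyclic p-group -/

section NoncyclicPGroupBound

variable {G : Type*} [Group G]

/-- At order `p ^ n` the single entry of M becomes at least p + 1, and G itself is new. -/
theorem card_subgroup_maximal_add_le [Finite G] {p n : ℕ} (hp : p.Prime)
    (hG : Nat.card G = p ^ (n + 1)) (hc : ¬ IsCyclic G) {M : Subgroup G} (hM : Nat.card M = p ^ n) :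
    Nat.card (Subgroup M) + p + 1 ≤ Nat.card (Subgroup G) := by
  rw [sum_numSubgroups_prime_pow hp hM, sum_numSubgroups_prime_pow hp hG,
    Finset.sum_range_succ, Finset.sum_range_succ _ (n + 1), Finset.sum_range_succ _ n,
    ← hM, numSubgroups_card, ← hG, numSubgroups_card, hM]
  have h1 := le_numSubgroups_maximal hp hG hc
  have h2 : ∑ i ∈ Finset.range n, numSubgroups M (p ^ i) ≤
      ∑ i ∈ Finset.range n, numSubgroups G (p ^ i) :=
    Finset.sum_le_sum fun i _ => numSubgroups_subgroup_le_self M _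
  omega

theorem eq_of_sq_eq_one_of_numSubgroups_two {M : Subgroup G} (hM : numSubgroups M 2 = 1) {s t : G}
    (hs : s ∈ M) (ht : t ∈ M) (hs1 : s ≠ 1) (ht1 : t ≠ 1) (hs2 : s ^ 2 = 1) (ht2 : t ^ 2 = 1) :
    s = t := by
  have h : zpowers s = zpowers t := by
    apply eq_of_le_of_numSubgroups_eq_one hM
    · rwa [zpowers_le]
    · rwa [zpowers_le]
    · rw [Nat.card_zpowers, orderOf_eq_prime hs2 hs1]
    · rw [Nat.card_zpowers, orderOf_eq_prime ht2 ht1]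
  obtain ⟨k, hk⟩ := mem_zpowers_iff.1 (h ▸ mem_zpowers s)
  rcases Int.even_or_odd' k with ⟨m, rfl | rfl⟩
  · rw [zpow_mul, zpow_ofNat, ht2, one_zpow] at hk
    exact absurd hk.symm hs1
  · rw [zpow_add, zpow_mul, zpow_ofNat, ht2, one_zpow, one_mul, zpow_one] at hk
    exact hk.symm

/-- Two noncyclic maximal subgroups have at least 3 subgroups of order 4 each and share at most one.
Otherwise two cyclic maximal subgroups force a central element x of order 4 inside M, which is
impossible when M is noncyclic with a unique involution: any u in M outside ⟨x⟩ has u ^ 2 = x ^ 2,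
so xu is an involution, hence equals x ^ 2, and u = x. -/
theorem five_le_numSubgroups_four [Finite G] (hG : Nat.card G = 2 ^ 4) (hc : ¬ IsCyclic G)
    {M : Subgroup G} (hM : Nat.card M = 2 ^ 3) (hMc : ¬ IsCyclic M) (hM2 : numSubgroups M 2 = 1) :
    5 ≤ numSubgroups G 4 := by
  by_cases hN : ∃ N : Subgroup G, Nat.card N = 2 ^ 3 ∧ N ≠ M ∧ ¬ IsCyclic N
  · obtain ⟨N, hN, hNM, hNc⟩ := hN
    have h1 := le_numSubgroups_maximal Nat.prime_two hM hMc
    have h2 := le_numSubgroups_maximal Nat.prime_two hN hNc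
    rw [numSubgroups_subgroup_eq] at h1 h2
    have h3 := Set.ncard_union_add_ncard_inter {H : Subgroup G | Nat.card H = 2 ^ 2 ∧ H ≤ M}
      {H : Subgroup G | Nat.card H = 2 ^ 2 ∧ H ≤ N} (Set.toFinite _) (Set.toFinite _)
    have h4 : ({H : Subgroup G | Nat.card H = 2 ^ 2 ∧ H ≤ M} ∩
        {H : Subgroup G | Nat.card H = 2 ^ 2 ∧ H ≤ N}).ncard ≤ 1 := by
      rw [Set.ncard_le_one (Set.toFinite _)]
      have hlt : Nat.card (M ⊓ N : Subgroup G) ≤ 4 := by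
        have h5 := card_dvd_of_le (inf_le_left : M ⊓ N ≤ M)
        rw [hM, Nat.dvd_prime_pow Nat.prime_two] at h5
        obtain ⟨k, hk, hk'⟩ := h5
        have hk3 : k ≠ 3 := by
          rintro rfl
          apply hNM
          rw [← eq_of_le_of_card_ge (inf_le_left : M ⊓ N ≤ M) (by omega)]
          exact (eq_of_le_of_card_ge inf_le_right (by omega)).symm
        rw [hk']
        exact Nat.pow_le_pow_right two_pos (by omega : k ≤ 2)
      rintro H ⟨⟨hH, hHM⟩, _, hHN⟩ K ⟨⟨hK, hKM⟩, _, hKN⟩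
      rw [eq_of_le_of_card_ge (le_inf hHM hHN) (by omega),
        eq_of_le_of_card_ge (le_inf hKM hKN) (by omega)]
    have h5 : ({H : Subgroup G | Nat.card H = 2 ^ 2 ∧ H ≤ M} ∪
        {H : Subgroup G | Nat.card H = 2 ^ 2 ∧ H ≤ N}).ncard ≤ numSubgroups G 4 := by
      apply Set.ncard_le_ncard _ (Set.toFinite _)
      rintro H (h | h)
      · exact h.1
      · exact h.1
    omega
  · exfalso
    push Not at hN
    obtain ⟨A, hA, B, hB, hAB⟩ : ∃ A ∈ {H : Subgroup G | Nat.card H = 2 ^ 3} \ {M},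
        ∃ B ∈ {H : Subgroup G | Nat.card H = 2 ^ 3} \ {M}, A ≠ B := by
      apply (Set.one_lt_ncard (Set.toFinite _)).1
      rw [Set.ncard_sdiff_singleton_of_mem (show M ∈ {H : Subgroup G | Nat.card H = 2 ^ 3} from hM)]
      have h := le_numSubgroups_maximal Nat.prime_two hG hc
      rw [numSubgroups] at h
      omega
    have hAc := hN A hA.1 hA.2
    have hBc := hN B hB.1 hB.2
    obtain ⟨L, hLM, hL⟩ := Sylow.exists_subgroup_le_card_pow_prime_of_le_card Nat.prime_two
      (IsPGroup.of_card hG) (card_inf_maximal Nat.prime_two hG hA.1 hM)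
    obtain ⟨K, hKAB, hK⟩ := Sylow.exists_subgroup_le_card_pow_prime_of_le_card Nat.prime_two
      (IsPGroup.of_card hG) (card_inf_maximal Nat.prime_two hG hA.1 hB.1)
    obtain rfl : L = K := eq_of_le_isCyclic hAc (hLM.trans inf_le_left) (hKAB.trans inf_le_left)
      (hL.trans hK.symm)
    have hLc : IsCyclic L :=
      isCyclic_of_injective (inclusion (hLM.trans inf_le_left)) (inclusion_injective _)
    obtain ⟨⟨x, hxL⟩, hx⟩ := hLc.exists_generator
    have hxo : orderOf x = 4 := by
      rw [← Subgroup.orderOf_mk x hxL, orderOf_eq_card_of_forall_mem_zpowers hx, hL]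
      rfl
    have hxc : ∀ g, x * g = g * x := fun g =>
      inf_cyclic_maximal_central Nat.prime_two hG hA.1 hB.1 hAB hAc hBc (hKAB hxL) g
    have hx4 : x ^ 4 = 1 := hxo ▸ pow_orderOf_eq_one x
    have hx2 : x ^ 2 ≠ 1 := fun h => by
      have := orderOf_dvd_of_pow_eq_one h
      rw [hxo] at this
      omega
    have hxM : x ∈ M := (hLM hxL).2
    obtain ⟨u, huM, huL⟩ : ∃ u ∈ M, u ∉ L := by
      by_contra! h
      have := Subgroup.card_le_of_le h
      omega
    have hu4 : u ^ 4 = 1 := by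
      have h1 := orderOf_dvd_natCard (⟨u, huM⟩ : M)
      rw [hM, Nat.dvd_prime_pow Nat.prime_two] at h1
      obtain ⟨k, hk, hk'⟩ := h1
      have hk3 : k ≠ 3 := by
        rintro rfl
        exact hMc (isCyclic_of_orderOf_eq_card _ (hk'.trans hM.symm))
      have h2 : orderOf u ∣ 2 ^ 2 := by
        rw [← Subgroup.orderOf_mk u huM, hk']
        exact pow_dvd_pow _ (by omega)
      exact orderOf_dvd_iff_pow_eq_one.1 h2
    have huniq : ∀ t ∈ M, t ≠ 1 → t ^ 2 = 1 → t = x ^ 2 := fun t ht ht1 ht2 =>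
      eq_of_sq_eq_one_of_numSubgroups_two hM2 ht (M.pow_mem hxM 2) ht1 hx2 ht2
        (by rw [← pow_mul, hx4])
    have hu1 : u ≠ 1 := fun h => huL (h ▸ L.one_mem)
    have hu2 : u ^ 2 ≠ 1 := fun h => huL (huniq u huM hu1 h ▸ L.pow_mem hxL 2)
    have hux : u ^ 2 = x ^ 2 := huniq _ (M.pow_mem huM 2) hu2 (by rw [← pow_mul, hu4])
    have hxu : (x * u) ^ 2 = 1 := by
      rw [(show Commute x u from hxc u).mul_pow, hux, ← pow_add, hx4]
    have hxu1 : x * u ≠ 1 := fun h => huL (by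
      rw [eq_inv_of_mul_eq_one_right h]
      exact L.inv_mem hxL)
    have h := huniq _ (M.mul_mem hxM huM) hxu1 hxu
    rw [pow_two, mul_right_inj] at h
    exact huL (h ▸ hxL)

theorem card_subgroup_of_card_two_pow_four [Finite G] (hG : Nat.card G = 2 ^ 4)
    (hc : ¬ IsCyclic G) : 11 ≤ Nat.card (Subgroup G) := by
  obtain ⟨M, hM, hMc⟩ := exists_not_isCyclic_maximal (e := 2) Nat.prime_two hG hc (by norm_num)
    (by norm_num) (by decide)
  -- Orders 1, 2, 4, 8, 16 give 1 + 1 + 5 + 3 + 1 = 11. With several involutions, M has at least 1 +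
  -- 3 + 3 + 1 = 8 subgroups, and G adds 3.
  by_cases hM2 : numSubgroups M 2 = 1
  · have h1 := five_le_numSubgroups_four hG hc hM hMc hM2
    have h2 := le_numSubgroups_maximal Nat.prime_two hG hc
    have h3 := sum_numSubgroups_prime_pow Nat.prime_two hG
    have h4 : ∀ i ≤ 4, 1 ≤ numSubgroups G (2 ^ i) := fun i hi =>
      numSubgroups_prime_pow_pos Nat.prime_two (hG ▸ pow_dvd_pow 2 hi)
    simp only [Finset.sum_range_succ, Finset.sum_range_zero, Nat.reduceAdd] at h3
    have := h4 0 (by norm_num)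
    have := h4 1 (by norm_num)
    have := h4 4 (by norm_num)
    norm_num at *
    omega
  · have h0 := IsPGroup.le_numSubgroups Nat.prime_two 3 1 (by norm_num) hM (by simpa using hM2)
    have h1 := card_subgroup_maximal_add_le Nat.prime_two hG hc hM
    have h2 := le_numSubgroups_maximal Nat.prime_two hM hMc
    have h3 := sum_numSubgroups_prime_pow Nat.prime_two hM
    have h4 : ∀ i ≤ 3, 1 ≤ numSubgroups M (2 ^ i) := fun i hi =>
      numSubgroups_prime_pow_pos Nat.prime_two (hM ▸ pow_dvd_pow 2 hi)
    simp only [Finset.sum_range_succ, Finset.sum_range_zero, Nat.reduceAdd] at h3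
    have := h4 0 (by norm_num)
    have := h4 3 (by norm_num)
    norm_num at *
    omega

theorem two_le_of_not_isCyclic [Finite G] {p a : ℕ} (hp : p.Prime) (hG : Nat.card G = p ^ a)
    (hc : ¬ IsCyclic G) : 2 ≤ a := by
  have := Fact.mk hp
  by_contra! h
  apply hc
  interval_cases a
  · have := (Nat.card_eq_one_iff_unique.1 (by simpa using hG)).1
    infer_instance
  · exact isCyclic_of_prime_card (p := p) (by simpa using hG)

theorem noncyclicPGroupBound_add_two {p n : ℕ} (h : p ≠ 2 ∨ n ≠ 1) :
    noncyclicPGroupBound p (n + 2) = (n + 1) * (p + 1) + 2 := by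
  unfold noncyclicPGroupBound
  split_ifs with h1 h2
  · obtain ⟨rfl, h1⟩ := h1
    obtain rfl : n = 0 := by omega
    norm_num
  · omega
  · rfl

theorem noncyclicPGroupBound_le [Finite G] {p a : ℕ} (hp : p.Prime) (hG : Nat.card G = p ^ a)
    (hc : ¬ IsCyclic G) : noncyclicPGroupBound p a ≤ Nat.card (Subgroup G) := by
  have ha := two_le_of_not_isCyclic hp hG hc
  obtain ⟨n, rfl⟩ : ∃ n, a = n + 2 := ⟨a - 2, by omega⟩
  clear ha
  induction n generalizing G with
  | zero =>
    rw [noncyclicPGroupBound_add_two (by omega)]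
    have h1 := le_numSubgroups_maximal hp hG hc
    have h2 := sum_numSubgroups_prime_pow hp hG
    simp only [Finset.sum_range_succ, Finset.sum_range_zero, zero_add] at h1 h2
    have h3 := numSubgroups_prime_pow_pos (G := G) (i := 0) hp (by simp)
    have h4 := numSubgroups_prime_pow_pos (G := G) (i := 2) hp (hG ▸ dvd_rfl)
    omega
  | succ n ih =>
    -- Orders 8 and 16 escape the induction: the quaternion group has only cyclic maximal subgroups,
    -- and the exceptional value 6 at order 8 would give only 9 at order 16.
    by_cases h2 : p = 2 ∧ n ≤ 1
    · obtain ⟨rfl, hn⟩ := h2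
      rcases Nat.le_one_iff_eq_zero_or_eq_one.1 hn with rfl | rfl
      · have h1 := le_numSubgroups_maximal hp hG hc
        have h2 := sum_numSubgroups_prime_pow hp hG
        have h3 : ∀ i ≤ 3, 1 ≤ numSubgroups G (2 ^ i) := fun i hi =>
          numSubgroups_prime_pow_pos hp (hG ▸ pow_dvd_pow 2 hi)
        have h4 := h3 0 (by norm_num)
        have h5 := h3 1 (by norm_num)
        have h6 := h3 3 le_rfl
        simp only [Finset.sum_range_succ, Finset.sum_range_zero, zero_add, Nat.reduceAdd] at h1 h2
        rw [show noncyclicPGroupBound 2 (0 + 1 + 2) = 6 from rfl]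
        omega
      · exact card_subgroup_of_card_two_pow_four hG hc
    · obtain ⟨M, hM, hMc⟩ : ∃ M : Subgroup G, Nat.card M = p ^ (n + 2) ∧ ¬ IsCyclic M := by
        by_cases hp2 : p = 2
        · subst hp2
          exact exists_not_isCyclic_maximal (e := 2) hp hG hc (by norm_num) (by omega) (by decide)
        · exact exists_not_isCyclic_maximal (e := 1) hp hG hc le_rfl (by omega)
            (by
              rw [pow_one]
              exact hp.dvd_choose_self two_ne_zero (lt_of_le_of_ne hp.two_le (Ne.symm hp2)))
      have h3 := ih hMc hM
      have h4 := card_subgroup_maximal_add_le hp hG hc hM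
      rw [noncyclicPGroupBound_add_two (by omega)] at h3 ⊢
      have : (n + 1 + 1) * (p + 1) = (n + 1) * (p + 1) + (p + 1) := by ring
      omega

end NoncyclicPGroupBound

/-! ### Groups of order p^a q^b -/

section TwoPrimes

variable {G : Type*} [Group G] {p q a b : ℕ}

theorem le_of_card_eq_prime_pow (hp : p.Prime) (hq : q.Prime) (hpq : p ≠ q)
    (hG : Nat.card G = p ^ a * q ^ b) {k : ℕ} {S : Subgroup G} (hS : Nat.card S = p ^ k) :
    k ≤ a := by
  have h := card_subgroup_dvd_card S
  rw [hS, hG] at h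
  exact (Nat.pow_dvd_pow_iff_le_right hp.one_lt).1
    ((Nat.Coprime.pow k b ((Nat.coprime_primes hp hq).2 hpq)).dvd_of_dvd_mul_right h)

theorem sylow_eq_of_card_eq [Finite G] (hp : p.Prime) (hq : q.Prime) (hpq : p ≠ q)
    (hG : Nat.card G = p ^ a * q ^ b) {P : Subgroup G} (hP : Nat.card P = p ^ a) {S : Sylow p G}
    (h : P ≤ S) : P = S := by
  have := Fact.mk hp
  apply eq_of_le_of_card_ge h
  rw [hP, S.card_eq_multiplicity]
  exact Nat.pow_le_pow_right hp.pos (le_of_card_eq_prime_pow hp hq hpq hG S.card_eq_multiplicity)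

theorem sylow_normal_of_normal [Finite G] (hp : p.Prime) (hq : q.Prime) (hpq : p ≠ q)
    (hG : Nat.card G = p ^ a * q ^ b) {P : Subgroup G} (hP : Nat.card P = p ^ a) (hn : P.Normal)
    (S : Sylow p G) : (S : Subgroup G).Normal := by
  have hPS : P ≤ S := by
    rw [← S.is_maximal' ((IsPGroup.of_card hP).to_sup_of_normal_left S.isPGroup') le_sup_right]
    exact le_sup_left
  rwa [← sylow_eq_of_card_eq hp hq hpq hG hP hPS]

theorem isNilpotent_of_normal [Finite G] (hp : p.Prime) (hq : q.Prime) (hpq : p ≠ q)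
    (hG : Nat.card G = p ^ a * q ^ b) {P Q : Subgroup G} (hP : Nat.card P = p ^ a)
    (hQ : Nat.card Q = q ^ b) (hPn : P.Normal) (hQn : Q.Normal) : Group.IsNilpotent G := by
  refine (Group.isNilpotent_of_finite_tfae.out 0 3 : _ ↔ _).2 ?_
  intro r hr S
  by_cases hrp : r = p
  · subst hrp
    exact sylow_normal_of_normal hp hq hpq hG hP hPn S
  by_cases hrq : r = q
  · subst hrq
    exact sylow_normal_of_normal hq hp hpq.symm (hG.trans (mul_comm _ _)) hQ hQn S
  have h := card_subgroup_dvd_card (S : Subgroup G)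
  rw [hG, S.card_eq_multiplicity] at h
  have h1 := Nat.Coprime.pow ((Nat.card G).factorization r) a
    ((Nat.coprime_primes hr.out hp).2 hrp)
  have h2 := Nat.Coprime.pow ((Nat.card G).factorization r) b
    ((Nat.coprime_primes hr.out hq).2 hrq)
  have h3 := Nat.Coprime.eq_one_of_dvd (h1.mul_right h2) h
  rw [← S.card_eq_multiplicity, card_eq_one] at h3
  rw [h3]
  infer_instance

/-- Burnside transfer: as p is the least prime divisor of the order, a cyclic Sylow p-subgroup has a
normal complement, the kernel of the transfer. -/
theorem exists_normal_of_isCyclic [Finite G] (hp : p.Prime) (hq : q.Prime) (hpq : p < q)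
    (hG : Nat.card G = p ^ a * q ^ b) {P : Subgroup G} (hP : Nat.card P = p ^ a)
    (hc : IsCyclic P) : ∃ Q : Subgroup G, Nat.card Q = q ^ b ∧ Q.Normal := by
  have := Fact.mk hp
  rcases Nat.eq_zero_or_pos a with rfl | ha
  · exact ⟨⊤, by rw [card_top, hG, pow_zero, one_mul], inferInstance⟩
  obtain ⟨S, hS⟩ := (IsPGroup.of_card hP).exists_le_sylow
  obtain rfl := sylow_eq_of_card_eq hp hq hpq.ne hG hP hS
  have hpG : p ∣ Nat.card G := hG ▸ (dvd_pow_self p ha.ne').mul_right _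
  have hmin : (Nat.card G).minFac = p := by
    have h1 : (Nat.card G).minFac.Prime := Nat.minFac_prime fun h => by
      rw [h, Nat.dvd_one] at hpG
      exact hp.one_lt.ne' hpG
    have h2 := Nat.minFac_le_of_dvd hp.two_le hpG
    have h3 := Nat.minFac_dvd (Nat.card G)
    set r := (Nat.card G).minFac
    rw [hG, h1.dvd_mul] at h3
    rcases h3 with h3 | h3
    · exact (Nat.prime_dvd_prime_iff_eq h1 hp).1 (h1.dvd_of_dvd_pow h3)
    · have := (Nat.prime_dvd_prime_iff_eq h1 hq).1 (h1.dvd_of_dvd_pow h3)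
      omega
  have h := (IsCyclic.isComplement' hmin hc).card_mul_card
  refine ⟨_, ?_, MonoidHom.normal_ker (MonoidHom.transferSylow S (hc.normalizer_le_centralizer hmin))⟩
  rw [hG, hP, mul_comm] at h
  exact Nat.eq_of_mul_eq_mul_left (pow_pos hp.pos _) h

theorem disjoint_of_prime_pow (hp : p.Prime) (hq : q.Prime) (hpq : p ≠ q) {i j : ℕ}
    {P Q : Subgroup G} (hP : Nat.card P = p ^ i) (hQ : Nat.card Q = q ^ j) : Disjoint P Q :=
  disjoint_of_coprime_natCard (by
    rw [hP, hQ]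
    exact Nat.Coprime.pow _ _ ((Nat.coprime_primes hp hq).2 hpq))

theorem le_numSubgroups_of_normal [Finite G] (hp : p.Prime) (hq : q.Prime) (hpq : p ≠ q) {i j : ℕ}
    {N P : Subgroup G} (hNn : N.Normal) (hN : Nat.card N = q ^ j) (hP : Nat.card P = p ^ a) :
    numSubgroups P (p ^ i) ≤ numSubgroups G (p ^ i * q ^ j) := by
  rw [mul_comm, ← hN]
  exact numSubgroups_subgroup_le N P (disjoint_of_prime_pow hq hp hpq.symm hN hP) _

theorem one_le_numSubgroups_of_normal [Finite G] (hp : p.Prime) (hq : q.Prime) (hpq : p ≠ q) {i j : ℕ}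
    {N P : Subgroup G} (hNn : N.Normal) (hN : Nat.card N = q ^ j) (hP : Nat.card P = p ^ a)
    (hi : i ≤ a) : 1 ≤ numSubgroups G (p ^ i * q ^ j) :=
  (numSubgroups_prime_pow_pos hp (hP ▸ pow_dvd_pow p hi)).trans
    (le_numSubgroups_of_normal hp hq hpq hNn hN hP)

/-- Either the subgroup of order `q ^ j` is unique, hence normal, or there are at least `q + 1`. -/
theorem exists_normal_or_le_numSubgroups [Finite G] (hq : q.Prime) {j : ℕ} (hj : q ^ j ∣ Nat.card G) :
    (∃ N : Subgroup G, N.Normal ∧ Nat.card N = q ^ j) ∨ q + 1 ≤ numSubgroups G (q ^ j) := by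
  have := Fact.mk hq
  by_cases h : numSubgroups G (q ^ j) = 1
  · left
    obtain ⟨N, hN⟩ := Sylow.exists_subgroup_card_pow_prime q hj
    exact ⟨N, normal_of_forall_card_eq N fun K hK =>
      eq_of_numSubgroups_eq_one h (hK.trans hN) hN, hN⟩
  · exact Or.inr (le_numSubgroups_prime_pow hq hj h)

/-- A normal N of order `q ^ j` yields a product with a p-subgroup at each of the a + 1 orders;
without one, the cell i = 0 alone holds q + 1 subgroups. -/
theorem le_sum_numSubgroups [Finite G] (hp : p.Prime) (hq : q.Prime) (hpq : p ≠ q)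
    (hG : Nat.card G = p ^ a * q ^ b) {P : Subgroup G} (hP : Nat.card P = p ^ a) {j : ℕ}
    (hj : j ≤ b) :
    1 + min a q ≤ ∑ i ∈ Finset.range (a + 1), numSubgroups G (p ^ i * q ^ j) := by
  rcases exists_normal_or_le_numSubgroups (G := G) hq
    (hG ▸ (pow_dvd_pow q hj).mul_left _) with ⟨N, hNn, hN⟩ | h
  · have h := Finset.card_nsmul_le_sum (Finset.range (a + 1))
      (fun i => numSubgroups G (p ^ i * q ^ j)) 1 fun i hi =>
        one_le_numSubgroups_of_normal hp hq hpq hNn hN hP (by simp at hi; omega)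
    simp only [Finset.card_range, smul_eq_mul, mul_one] at h
    have := min_le_left a q
    omega
  · rw [Finset.sum_range_succ']
    simp only [pow_zero, one_mul]
    have := min_le_right a q
    omega

theorem le_numSubgroups_of_not_normal_sylow [Finite G] (hq : q.Prime)
    (hp : p.Prime) (hG : Nat.card G = p ^ a * q ^ b) {P : Subgroup G} (hP : Nat.card P = p ^ a)
    (hn : ¬ P.Normal) : q ≤ numSubgroups G (p ^ a) := by
  rw [← hP]
  refine le_numSubgroups_of_not_normal (b := b) hq ?_ hn
  refine (index_dvd_of_le le_normalizer).trans (dvd_of_eq ?_)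
  have := card_mul_index P
  rw [hG, hP] at this
  exact Nat.eq_of_mul_eq_mul_left (pow_pos hp.pos _) this

theorem boundThd_le [Finite G] (hp : p.Prime) (hq : q.Prime) (hpq : p ≠ q)
    (hG : Nat.card G = p ^ a * q ^ b) (hb : 1 ≤ b) {P Q : Subgroup G} (hP : Nat.card P = p ^ a)
    (hQ : Nat.card Q = q ^ b) (hn : ¬ (P.Normal ∧ Q.Normal)) (hc : ¬ IsCyclic P) :
    boundThd p q a b ≤ Nat.card (Subgroup G) := by
  have ha := two_le_of_not_isCyclic hp hP hc
  refine le_trans ?_ (sum_sum_numSubgroups_le hp hq hpq a b)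
  rw [Finset.sum_comm]
  obtain ⟨m, rfl⟩ : ∃ m, b = m + 1 := ⟨b - 1, by omega⟩
  rw [Finset.sum_range_succ, Finset.sum_range_succ']
  have h1 := Finset.card_nsmul_le_sum (Finset.range m)
    (fun j => ∑ i ∈ Finset.range (a + 1), numSubgroups G (p ^ i * q ^ (j + 1))) (1 + min a q)
    fun j hj => le_sum_numSubgroups hp hq hpq hG hP (by simp at hj; omega)
  rw [Finset.card_range, smul_eq_mul] at h1
  have h2 := noncyclicPGroupBound_le hp hP hc
  rw [sum_numSubgroups_prime_pow hp hP] at h2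
  simp only [pow_zero, mul_one]
  unfold boundThd
  rw [Nat.add_sub_cancel]
  have h3 : m * (1 + min a q) = m + m * min a q := by ring
  -- The line j = 0 carries `noncyclicPGroupBound p a`, and the lines strictly between contribute `1
  -- + min a q` each. If Q is normal, the last line has a + 1 and the q Sylow p-subgroups add q - 1,
  -- enough since a ≥ 2. If not, the last line has q + 1 Sylow q-subgroups and G.
  by_cases hQn : Q.Normal
  · have h4 : a + 1 ≤ ∑ i ∈ Finset.range (a + 1), numSubgroups G (p ^ i * q ^ (m + 1)) := by
      have h := Finset.card_nsmul_le_sum (Finset.range (a + 1))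
        (fun i => numSubgroups G (p ^ i * q ^ (m + 1))) 1 fun i hi =>
          one_le_numSubgroups_of_normal hp hq hpq hQn hQ hP (by simp at hi; omega)
      simpa using h
    have h5 := le_numSubgroups_of_not_normal_sylow hq hp hG hP fun h => hn ⟨h, hQn⟩
    have h6 : ∑ i ∈ Finset.range a, numSubgroups P (p ^ i) ≤
        ∑ i ∈ Finset.range a, numSubgroups G (p ^ i) :=
      Finset.sum_le_sum fun i _ => numSubgroups_subgroup_le_self P _
    have h7 : numSubgroups P (p ^ a) = 1 := hP ▸ numSubgroups_card
    rw [Finset.sum_range_succ, h7] at h2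
    rw [Finset.sum_range_succ (fun i => numSubgroups G (p ^ i))]
    omega
  · have h4 : q + 1 + 1 ≤ ∑ i ∈ Finset.range (a + 1), numSubgroups G (p ^ i * q ^ (m + 1)) := by
      obtain ⟨n, rfl⟩ : ∃ n, a = n + 1 := ⟨a - 1, by omega⟩
      rw [Finset.sum_range_succ, Finset.sum_range_succ', ← hG, numSubgroups_card]
      have : q + 1 ≤ numSubgroups G (q ^ (m + 1)) := by
        apply le_numSubgroups_prime_pow hq (hG ▸ Dvd.intro_left _ rfl)
        intro h
        exact hQn (normal_of_forall_card_eq Q fun K hK =>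
          eq_of_numSubgroups_eq_one h (hK.trans hQ) hQ)
      simp only [pow_zero, one_mul]
      omega
    have h6 : ∑ i ∈ Finset.range (a + 1), numSubgroups P (p ^ i) ≤
        ∑ i ∈ Finset.range (a + 1), numSubgroups G (p ^ i) :=
      Finset.sum_le_sum fun i _ => numSubgroups_subgroup_le_self P _
    omega

/-- The line i = 0 carries the noncyclic bound (b - 1)(q + 1) + 2 for Q, the line i = a has q Sylow
p-subgroups and G, and each line between has at least 2 + min(p, b). -/
theorem boundSnd_le [Finite G] (hp : p.Prime) (hq : q.Prime) (hpq : p < q)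
    (hG : Nat.card G = p ^ a * q ^ b) (ha : 1 ≤ a) {P Q : Subgroup G} (hP : Nat.card P = p ^ a)
    (hQ : Nat.card Q = q ^ b) (hPn : ¬ P.Normal) (hQn : Q.Normal) (hc : ¬ IsCyclic Q) :
    boundSnd p q a b ≤ Nat.card (Subgroup G) := by
  have hb := two_le_of_not_isCyclic hq hQ hc
  refine le_trans ?_ (sum_sum_numSubgroups_le hp hq hpq.ne a b)
  obtain ⟨n, rfl⟩ : ∃ n, a = n + 1 := ⟨a - 1, by omega⟩
  obtain ⟨m, rfl⟩ : ∃ m, b = m + 2 := ⟨b - 2, by omega⟩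
  rw [Finset.sum_range_succ, Finset.sum_range_succ']
  have h2 := noncyclicPGroupBound_le hq hQ hc
  rw [noncyclicPGroupBound_add_two (by have := hp.two_le; omega),
    sum_numSubgroups_prime_pow hq hQ] at h2
  have hmul : (m + 1) * (q + 1) = m * q + q + m + 1 := by ring
  have h1 := Finset.card_nsmul_le_sum (Finset.range n)
    (fun i => ∑ j ∈ Finset.range (m + 2 + 1), numSubgroups G (p ^ (i + 1) * q ^ j))
    (2 + min p (m + 2)) (by
      intro i hi
      rw [Finset.mem_range] at hi
      -- A normal p-subgroup copies all subgroups of Q into this line; otherwise there are p + 1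
      -- subgroups of this p-power order, and a product with Q gives one more.
      rcases exists_normal_or_le_numSubgroups (G := G) hp (j := i + 1)
        (hG ▸ (pow_dvd_pow p (by omega)).mul_right _) with ⟨N, hNn, hN⟩ | h
      · have h3 : ∑ j ∈ Finset.range (m + 2 + 1), numSubgroups Q (q ^ j) ≤
            ∑ j ∈ Finset.range (m + 2 + 1), numSubgroups G (p ^ (i + 1) * q ^ j) :=
          Finset.sum_le_sum fun j _ => by
            rw [mul_comm]
            exact le_numSubgroups_of_normal hq hp hpq.ne' hNn hN hQ
        have := min_le_right p (m + 2)
        have := hq.two_le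
        omega
      · have h3 := one_le_numSubgroups_of_normal hp hq hpq.ne (i := i + 1) hQn hQ hP (by omega)
        rw [Finset.sum_range_succ, Finset.sum_range_succ']
        simp only [pow_zero, mul_one]
        have := min_le_left p (m + 2)
        omega)
  rw [Finset.card_range, smul_eq_mul] at h1
  have h4 : q + 1 ≤ ∑ j ∈ Finset.range (m + 2 + 1), numSubgroups G (p ^ (n + 1) * q ^ j) := by
    have h5 := le_numSubgroups_of_not_normal_sylow hq hp hG hP hPn
    rw [Finset.sum_range_succ, Finset.sum_range_succ', ← hG, numSubgroups_card]
    simp only [pow_zero, mul_one]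
    omega
  have h6 : ∑ j ∈ Finset.range (m + 2 + 1), numSubgroups Q (q ^ j) ≤
      ∑ j ∈ Finset.range (m + 2 + 1), numSubgroups G (q ^ j) :=
    Finset.sum_le_sum fun i _ => numSubgroups_subgroup_le_self Q _
  simp only [pow_zero, one_mul]
  unfold boundSnd
  rw [Nat.add_sub_cancel]
  have h7 : n * (2 + min p (m + 2)) = 2 * n + n * min p (m + 2) := by ring
  have h8 : (m + 2) * (q + 1) = (m + 1) * (q + 1) + q + 1 := by ring
  omega

theorem exists_le_card_eq_prime_pow [Finite G] (hp : p.Prime) {H : Subgroup G} {k : ℕ}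
    (hH : Nat.card H = p ^ a) (hk : k ≤ a) : ∃ K ≤ H, Nat.card K = p ^ k := by
  have := Fact.mk hp
  obtain ⟨K, hK⟩ := Sylow.exists_subgroup_card_pow_prime p (hH ▸ pow_dvd_pow p hk : p ^ k ∣ _)
  refine ⟨K.map H.subtype, map_subtype_le K, ?_⟩
  rw [← hK, Nat.card_congr (K.equivMapOfInjective _ H.subtype_injective).symm.toEquiv]

theorem le_total_of_isCyclic [Finite G] (hq : q.Prime) {Q H K : Subgroup G} (hQ : Nat.card Q = q ^ b)
    (hc : IsCyclic Q) (hH : H ≤ Q) (hK : K ≤ Q) : H ≤ K ∨ K ≤ H := by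
  have hcard : ∀ L ≤ Q, ∃ k, Nat.card L = q ^ k := fun L hL => by
    have h := card_dvd_of_le hL
    rw [hQ, Nat.dvd_prime_pow hq] at h
    obtain ⟨k, -, hk⟩ := h
    exact ⟨k, hk⟩
  have key : ∀ (H K : Subgroup G) (i j : ℕ), H ≤ Q → K ≤ Q → Nat.card H = q ^ i →
      Nat.card K = q ^ j → i ≤ j → H ≤ K := by
    intro H K i j hH hK hi hj hij
    obtain ⟨L, hLK, hL⟩ := exists_le_card_eq_prime_pow hq hj hij
    rwa [eq_of_le_isCyclic hc hH (hLK.trans hK) (hi.trans hL.symm)]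
  obtain ⟨i, hi⟩ := hcard H hH
  obtain ⟨j, hj⟩ := hcard K hK
  rcases le_total i j with h | h
  · exact Or.inl (key H K i j hH hK hi hj h)
  · exact Or.inr (key K H j i hK hH hj hi h)

/-- A Frattini argument: a proper subgroup of a cyclic Sylow subgroup cannot be enlarged to a normal
subgroup by a non-normal Sylow subgroup for the other prime. -/
theorem sup_not_normal [Finite G] (hp : p.Prime) (hq : q.Prime) (hpq : p ≠ q)
    (hG : Nat.card G = p ^ a * q ^ b) {P Q N : Subgroup G} (hP : Nat.card P = p ^ a)
    (hQ : Nat.card Q = q ^ b) (hPn : ¬ P.Normal) (hc : IsCyclic Q) (hNn : N.Normal) (hNQ : N ≤ Q)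
    (hN : N ≠ Q) : ¬ (N ⊔ P).Normal := by
  intro hn
  have := Fact.mk hp
  obtain ⟨S, hS⟩ := (IsPGroup.of_card hP).exists_le_sylow
  obtain rfl := sylow_eq_of_card_eq hp hq hpq hG hP hS
  have h1 := S.normalizer_sup_eq_top' (N := N ⊔ S) le_sup_right
  have hSR : (S : Subgroup G) ≤ normalizer (S : Set G) := le_normalizer
  set R := normalizer (S : Set G)
  have h2 : N ⊔ R = ⊤ := by
    rw [sup_comm, sup_assoc, sup_eq_right.2 hSR] at h1
    exact h1
  -- Here G = N R with R the normalizer of the Sylow subgroup. Subgroups of Q form a chain: N ≤ R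
  -- gives R = G, while R ∩ Q ≤ N gives Q ≤ N by Dedekind's law.
  rcases le_total_of_isCyclic hq hQ hc hNQ (inf_le_right : R ⊓ Q ≤ Q) with h | h
  · rw [sup_eq_right.2 (h.trans inf_le_left)] at h2
    exact hPn (normalizer_eq_top_iff.1 h2)
  · refine hN (le_antisymm hNQ fun g hg => ?_)
    obtain ⟨y, hy, z, hz, hyz⟩ := mem_sup_of_normal_left.1 (h2 ▸ mem_top g : g ∈ N ⊔ R)
    have hzQ : z ∈ Q := by
      rw [eq_inv_mul_of_mul_eq hyz]
      exact Q.mul_mem (Q.inv_mem (hNQ hy)) hg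
    exact hyz ▸ N.mul_mem hy (h ⟨hz, hzQ⟩)

/-- Subgroups of a cyclic normal Q are normal in G, so every cell is inhabited: a(b + 1) for i < a.
For i = a and j < b, the product of P with the subgroup of order `q ^ j` is not normal by
`sup_not_normal`, so it has at least q conjugates. G itself supplies the final 1. -/
theorem boundFst_le [Finite G] (hp : p.Prime) (hq : q.Prime) (hpq : p ≠ q)
    (hG : Nat.card G = p ^ a * q ^ b) {P Q : Subgroup G} (hP : Nat.card P = p ^ a)
    (hQ : Nat.card Q = q ^ b) (hPn : ¬ P.Normal) (hQn : Q.Normal) (hc : IsCyclic Q) :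
    boundFst q a b ≤ Nat.card (Subgroup G) := by
  refine le_trans ?_ (sum_sum_numSubgroups_le hp hq hpq a b)
  have hex : ∀ j ≤ b, ∃ N : Subgroup G, N.Normal ∧ N ≤ Q ∧ Nat.card N = q ^ j := by
    intro j hj
    obtain ⟨N, hNQ, hN⟩ := exists_le_card_eq_prime_pow hq hQ hj
    refine ⟨N, Normal.of_conjugate_fixed fun g => ?_, hNQ, hN⟩
    refine eq_of_le_isCyclic hc ?_ hNQ (card_conj_smul g N)
    rw [← Normal.conj_smul_eq_self g Q]
    exact pointwise_smul_le_pointwise_smul_iff.2 hNQ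
  have hlow : (a * (b + 1)) ≤
      ∑ i ∈ Finset.range a, ∑ j ∈ Finset.range (b + 1), numSubgroups G (p ^ i * q ^ j) := by
    have h := Finset.card_nsmul_le_sum (Finset.range a)
      (fun i => ∑ j ∈ Finset.range (b + 1), numSubgroups G (p ^ i * q ^ j)) (b + 1) (by
        intro i hi
        rw [Finset.mem_range] at hi
        have h := Finset.card_nsmul_le_sum (Finset.range (b + 1))
          (fun j => numSubgroups G (p ^ i * q ^ j)) 1 (by
            intro j hj
            rw [Finset.mem_range] at hj
            obtain ⟨N, hNn, -, hN⟩ := hex j (by omega)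
            exact one_le_numSubgroups_of_normal hp hq hpq hNn hN hP hi.le)
        simpa using h)
    simpa using h
  have htop : b * q ≤ ∑ j ∈ Finset.range b, numSubgroups G (p ^ a * q ^ j) := by
    have h := Finset.card_nsmul_le_sum (Finset.range b)
      (fun j => numSubgroups G (p ^ a * q ^ j)) q (by
        intro j hj
        rw [Finset.mem_range] at hj
        obtain ⟨N, hNn, hNQ, hN⟩ := hex j hj.le
        have hNQ' : N ≠ Q := by
          rintro rfl
          exact hj.ne (Nat.pow_right_injective hq.two_le (hN.symm.trans hQ))
        have h1 := sup_not_normal hp hq hpq hG hP hQ hPn hc hNn hNQ hNQ'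
        have hcard : Nat.card (N ⊔ P : Subgroup G) = p ^ a * q ^ j := by
          rw [card_sup_of_disjoint N P (disjoint_of_prime_pow hq hp hpq.symm hN hP), hN, hP, mul_comm]
        rw [← hcard]
        refine le_numSubgroups_of_not_normal (b := b) hq ?_ h1
        have h2 : P ≤ normalizer ((N ⊔ P : Subgroup G) : Set G) := le_sup_right.trans le_normalizer
        refine (index_dvd_of_le h2).trans (dvd_of_eq ?_)
        have := card_mul_index P
        rw [hG, hP] at this
        exact Nat.eq_of_mul_eq_mul_left (pow_pos hp.pos _) this)
    simpa using h
  rw [Finset.sum_range_succ, Finset.sum_range_succ (fun j => numSubgroups G (p ^ a * q ^ j)), ← hG,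
    numSubgroups_card]
  unfold boundFst
  have : a * (b + 1) = a * b + a := by ring
  omega

end TwoPrimes

/-! ### The case distinction on cyclic Sylow subgroups -/

theorem mainTheorem3 {G : Type*} [Group G] (p q a b : ℕ)
    (hp : p.Prime) (hq : q.Prime) (hpq : p < q)
    (hcard : Nat.card G = p ^ a * q ^ b)
    (hG : ¬ Group.IsNilpotent G) :
    nonnilpotentBound p q a b ≤ (Nat.card (Subgroup G) : ℕ∞) := by
  have : Finite G := Nat.finite_of_card_ne_zero (by
    rw [hcard]
    exact (Nat.mul_pos (pow_pos hp.pos _) (pow_pos hq.pos _)).ne')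
  have := Fact.mk hp
  have := Fact.mk hq
  obtain ⟨P, hP⟩ := Sylow.exists_subgroup_card_pow_prime p (hcard ▸ Dvd.intro _ rfl : p ^ a ∣ _)
  unfold nonnilpotentBound
  by_cases hPc : IsCyclic P
  · obtain ⟨Q, hQ, hQn⟩ := exists_normal_of_isCyclic hp hq hpq hcard hP hPc
    have hPn : ¬ P.Normal := fun h => hG (isNilpotent_of_normal hp hq hpq.ne hcard hP hQ h hQn)
    by_cases hQc : IsCyclic Q
    · exact (min_le_left _ _).trans
        (Nat.cast_le.2 (boundFst_le hp hq hpq.ne hcard hP hQ hPn hQn hQc))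
    · have ha : 1 ≤ a := by
        by_contra! h
        obtain rfl : a = 0 := by omega
        rw [pow_zero, card_eq_one] at hP
        exact hPn (hP ▸ inferInstance)
      refine (min_le_right _ _).trans ((min_le_left _ _).trans ?_)
      rw [if_pos (show 1 < b from two_le_of_not_isCyclic hq hQ hQc)]
      exact Nat.cast_le.2 (boundSnd_le hp hq hpq hcard ha hP hQ hPn hQn hQc)
  · obtain ⟨Q, hQ⟩ := Sylow.exists_subgroup_card_pow_prime q
      (hcard ▸ Dvd.intro_left _ rfl : q ^ b ∣ _)
    have hb : 1 ≤ b := by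
      by_contra! h
      obtain rfl : b = 0 := by omega
      rw [pow_zero, mul_one] at hcard
      exact hG (IsPGroup.of_card hcard).isNilpotent
    refine (min_le_right _ _).trans ((min_le_right _ _).trans ?_)
    rw [if_pos (show 1 < a from two_le_of_not_isCyclic hp hP hPc)]
    exact Nat.cast_le.2 (boundThd_le hp hq hpq.ne hcard hb hP hQ
      (fun h => hG (isNilpotent_of_normal hp hq hpq.ne hcard hP hQ h.1 h.2)) hPc)
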